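/- Let $\tau$ be the product trace on the algebraic infinite tensor product $\bigotimes_{n\ge1}M_2(\mathbb C)$ (the union of the algebras $M_2(\mathbb C)^{\otimes n}$ along $x\mapsto x\otimes 1$), i.e. the functional that restricts to the normalized trace on each $M_2(\mathbb C)^{\otimes n}$. Let $\mathcal H=L^2\big(\bigotimes_{n\ge1}M_2(\mathbb C),\tau\big)$ be the completion for the inner product $\langle a,b\rangle=\tau(a^*b)$, on which $\bigotimes_{n\ge1}M_2(\mathbb C)$ acts by left multiplication, and let the hyperfinite $\mathrm{II}_1$ factor $\mathcal R\subset\mathcal B(\mathcal H)$ be the closure of the image of this representation in the weak operator topology. Put $$V=\begin{pmatrix}0&1\\0&0\end{pmatrix},\qquad V_n=I^{\otimes(n-1)}\otimes V\in\mathcal R\quad(n\ge1).$$ Let $0<\alpha<1$. Then the series $$A=\sum_{n=1}^{\infty}\alpha^nV_n$$ converges in operator norm to an element of $\mathcal R$, and the operator $A:\mathcal H\to\mathcal H$ has trivial kernel, $\mathrm{Ker}(A)=\{0\}$, and dense range, $\overline{A\mathcal H}=\mathcal H$. -/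

import Mathlib

open scoped Kronecker

namespace Hyperfinite

/-- The `n`-fold tensor power `M₂(ℂ)^{⊗ n}`: complex matrices indexed by words of length `n` in
the letters `0, 1` (the standard basis of `(ℂ²)^{⊗ n}`). -/
abbrev Level (n : ℕ) : Type := Matrix (Fin n → Fin 2) (Fin n → Fin 2) ℂ

/-- The elementary tensor `x 0 ⊗ x 1 ⊗ ⋯ ⊗ x (n - 1)` in `M₂(ℂ)^{⊗ n}`. -/
def elemTensor {n : ℕ} (x : Fin n → Matrix (Fin 2) (Fin 2) ℂ) : Level n :=
  Matrix.of fun i j => ∏ k, x k (i k) (j k)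

/-- Cutting a word of length `n` into its first `m` letters and the remaining ones. -/
def splitWord {m n : ℕ} (h : m ≤ n) :
    (Fin n → Fin 2) ≃ (Fin m → Fin 2) × ({k : Fin n // ¬ (k : ℕ) < m} → Fin 2) :=
  (Equiv.piEquivPiSubtypeProd (fun k : Fin n => (k : ℕ) < m) (fun _ => Fin 2)).trans
    (Equiv.prodCongr
      (Equiv.arrowCongr (Fin.castLEquiv h).symm (Equiv.refl (Fin 2))) (Equiv.refl _))

/-- The inclusion `x ↦ x ⊗ 1` of `M₂(ℂ)^{⊗ m}` into `M₂(ℂ)^{⊗ n}` for `m ≤ n`. -/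
def incl (m n : ℕ) (h : m ≤ n) : Level m →⋆ₐ[ℂ] Level n where
  toFun x := Matrix.reindex (splitWord h).symm (splitWord h).symm
    (x ⊗ₖ (1 : Matrix ({k : Fin n // ¬ (k : ℕ) < m} → Fin 2) _ ℂ))
  map_one' := by simp
  map_mul' x y := by
    simp [Matrix.submatrix_mul_equiv, ← Matrix.mul_kronecker_mul]
  map_zero' := by simp
  map_add' x y := by
    rw [Matrix.add_kronecker]; rfl
  commutes' r := by
    rw [Algebra.algebraMap_eq_smul_one, Algebra.algebraMap_eq_smul_one, Matrix.smul_kronecker,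
      Matrix.one_kronecker_one, Matrix.reindex_apply, Matrix.submatrix_smul]
    simp
  map_star' x := by
    simp [Matrix.star_eq_conjTranspose, Matrix.conjTranspose_kronecker]

theorem incl_apply {m n : ℕ} (h : m ≤ n) (x : Level m) (i j : Fin n → Fin 2) :
    incl m n h x i j =
      if ∀ k : Fin n, m ≤ (k : ℕ) → i k = j k then
        x (fun k => i (Fin.castLE h k)) (fun k => j (Fin.castLE h k)) else 0 := by
  have key : ((splitWord h i).2 = (splitWord h j).2) ↔ ∀ k : Fin n, m ≤ (k : ℕ) → i k = j k := by
    constructor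
    · intro e k hk
      exact congrFun e ⟨k, not_lt.mpr hk⟩
    · intro e
      funext k
      exact e k.1 (not_lt.mp k.2)
  change x (splitWord h i).1 (splitWord h j).1 *
    (1 : Matrix _ _ ℂ) (splitWord h i).2 (splitWord h j).2 = _
  rw [Matrix.one_apply]
  simp only [key]
  split_ifs
  · rw [mul_one]; rfl
  · rw [mul_zero]

instance : DirectedSystem Level (incl · · ·) where
  map_self n x := by
    ext i j
    have h : ∀ k : Fin n, n ≤ (k : ℕ) → i k = j k := fun k hk => absurd k.2 (not_lt.mpr hk)
    rw [incl_apply, if_pos h]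
    rfl
  map_map n m k h₁ h₂ x := by
    ext i j
    simp only [incl_apply]
    by_cases hc : ∀ l : Fin n, k ≤ (l : ℕ) → i l = j l
    · rw [if_pos hc, if_pos fun l hl => hc l (h₁.trans hl)]
      exact if_pos fun l hl => hc (Fin.castLE h₂ l) hl
    · rw [if_neg hc]
      split_ifs with ha hb
      · refine absurd (fun l hl => ?_) hc
        by_cases hm : m ≤ (l : ℕ)
        · exact ha l hm
        · exact hb ⟨l, not_le.mp hm⟩ hl
      · rfl
      · rfl

/-- The algebraic infinite tensor product `⨂_{n ≥ 1} M₂(ℂ)`, as the union (direct limit) of the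
`M₂(ℂ)^{⊗ n}` along the inclusions `x ↦ x ⊗ 1`. -/
def TensorAlg : Type := DirectLimit Level incl

namespace TensorAlg

noncomputable instance : Ring TensorAlg := inferInstanceAs (Ring (DirectLimit Level incl))

noncomputable instance : Algebra ℂ TensorAlg :=
  inferInstanceAs (Algebra ℂ (DirectLimit Level incl))

noncomputable instance : StarRing TensorAlg where
  star := (inferInstance : Star (DirectLimit Level incl)).star
  star_involutive := (inferInstance : InvolutiveStar (DirectLimit Level incl)).star_involutive
  star_mul := (inferInstance : StarMul (DirectLimit Level incl)).star_mul
  star_add := (inferInstance : StarAddMonoid (DirectLimit Level incl)).star_add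

instance : StarModule ℂ TensorAlg where
  star_smul := (inferInstance : StarModule ℂ (DirectLimit Level incl)).star_smul

/-- The canonical embedding of `M₂(ℂ)^{⊗ n}` (the first `n` tensor factors). -/
noncomputable def of (n : ℕ) : Level n →⋆ₐ[ℂ] TensorAlg where
  __ := DirectLimit.Algebra.of Level incl n
  map_star' _ := rfl

theorem exists_of (a : TensorAlg) : ∃ n x, a = of n x :=
  DirectLimit.exists_eq_mk (f := incl) a

theorem trace_incl {m n : ℕ} (h : m ≤ n) (x : Level m) :
    ((2 : ℂ) ^ n)⁻¹ * (incl m n h x).trace = ((2 : ℂ) ^ m)⁻¹ * x.trace := by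
  have h1 : (incl m n h x).trace = x.trace * (2 : ℂ) ^ (n - m) := by
    change ((x ⊗ₖ (1 : Matrix ({k : Fin n // ¬ (k : ℕ) < m} → Fin 2) _ ℂ)).submatrix
      (splitWord h) (splitWord h)).trace = _
    have hc : Fintype.card {k : Fin n // ¬ (k : ℕ) < m} = n - m := by
      have e := Fintype.card_congr (Fin.castLEquiv h)
      rw [Fintype.card_subtype_compl, ← e]
      simp
    have ht : ∀ M : Matrix ((Fin m → Fin 2) × ({k : Fin n // ¬ (k : ℕ) < m} → Fin 2)) _ ℂ,
        (M.submatrix (splitWord h) (splitWord h)).trace = M.trace := fun M =>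
      (splitWord h).sum_comp fun i => M i i
    rw [ht, Matrix.trace_kronecker, Matrix.trace_one, Fintype.card_fun,
      hc]
    simp
  rw [h1, ← pow_sub_mul_pow (2 : ℂ) h]
  field_simp

/-- The product trace `τ`: on `M₂(ℂ)^{⊗ n}` it is the normalized trace. -/
noncomputable def tau : TensorAlg →ₗ[ℂ] ℂ :=
  DirectLimit.Module.lift ℂ ℕ Level incl
    (fun n => ((2 : ℂ) ^ n)⁻¹ • Matrix.traceLinearMap (Fin n → Fin 2) ℂ ℂ)
    (fun _ _ h x => trace_incl h x)

theorem tau_of (n : ℕ) (x : Level n) : tau (of n x) = ((2 : ℂ) ^ n)⁻¹ * x.trace := rfl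

theorem tau_star (a : TensorAlg) : tau (star a) = star (tau a) := by
  obtain ⟨n, x, rfl⟩ := exists_of a
  rw [← map_star, tau_of, tau_of, Matrix.star_eq_conjTranspose, Matrix.trace_conjTranspose]
  simp

theorem re_tau_nonneg (a : TensorAlg) : 0 ≤ (tau (star a * a)).re := by
  obtain ⟨n, x, rfl⟩ := exists_of a
  rw [← map_star, ← map_mul, tau_of, Matrix.star_eq_conjTranspose, Matrix.trace]
  have h : ((2 : ℂ) ^ n)⁻¹ = ((((2 : ℝ) ^ n)⁻¹ : ℝ) : ℂ) := by push_cast; rfl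
  rw [h, Complex.re_ofReal_mul, Complex.re_sum]
  refine mul_nonneg (by positivity) (Finset.sum_nonneg fun i _ => ?_)
  rw [Matrix.diag_apply, Matrix.mul_apply, Complex.re_sum]
  refine Finset.sum_nonneg fun j _ => ?_
  rw [Matrix.conjTranspose_apply, Complex.star_def, ← Complex.normSq_eq_conj_mul_self,
    Complex.ofReal_re]
  exact Complex.normSq_nonneg _

/-- The inner product `⟪a, b⟫ = τ(a* b)` on the algebraic tensor product. -/
noncomputable abbrev innerCore : PreInnerProductSpace.Core ℂ TensorAlg where
  inner a b := tau (star a * b)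
  conj_inner_symm a b := by
    rw [← Complex.star_def, ← tau_star, star_mul, star_star]
  re_inner_nonneg a := re_tau_nonneg a
  add_left a b c := by rw [star_add, add_mul, map_add]
  smul_left a b r := by rw [star_smul, smul_mul_assoc, map_smul, smul_eq_mul]; rfl

noncomputable instance : SeminormedAddCommGroup TensorAlg :=
  InnerProductSpace.Core.toSeminormedAddCommGroup (c := innerCore)

noncomputable instance : InnerProductSpace ℂ TensorAlg := InnerProductSpace.ofCore innerCore

theorem inner_def (a b : TensorAlg) : inner ℂ a b = tau (star a * b) := rfl

theorem norm_sq_eq (a : TensorAlg) : ‖a‖ ^ 2 = (tau (star a * a)).re := by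
  rw [← inner_def, ← inner_self_eq_norm_sq (𝕜 := ℂ) a]; rfl

open scoped Matrix.Norms.L2Operator MatrixOrder in
theorem exists_mul_bound (a : TensorAlg) : ∃ C : ℝ, ∀ b : TensorAlg, ‖a * b‖ ≤ C * ‖b‖ := by
  obtain ⟨n, x, rfl⟩ := exists_of a
  obtain ⟨C, hC, d, hd⟩ : ∃ C : ℝ, 0 ≤ C ∧ ∃ d : Level n,
      ((C ^ 2 : ℝ) : ℂ) • (1 : Level n) - star x * x = star d * d := by
    refine ⟨‖x‖, norm_nonneg _, ?_⟩
    have h := CStarAlgebra.star_mul_le_algebraMap_norm_sq (a := x)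
    obtain ⟨d, hd⟩ := CStarAlgebra.nonneg_iff_eq_star_mul_self.mp (sub_nonneg.mpr h)
    refine ⟨d, ?_⟩
    rw [← hd, Algebra.algebraMap_eq_smul_one, Complex.coe_smul]
  refine ⟨C, fun b => ?_⟩
  refine le_of_sq_le_sq ?_ (by positivity)
  have h2 : 0 ≤ (tau (star (of n d * b) * (of n d * b))).re := re_tau_nonneg _
  have h3 : star (of n d * b) * (of n d * b) =
      ((C ^ 2 : ℝ) : ℂ) • (star b * b) - star (of n x * b) * (of n x * b) := by
    have h4 : star (of n d) * of n d = ((C ^ 2 : ℝ) : ℂ) • 1 - star (of n x) * of n x := by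
      rw [← map_star, ← map_star, ← map_mul, ← map_mul, ← hd, map_sub, map_smul, map_one]
    calc _ = star b * (star (of n d) * of n d) * b := by rw [star_mul]; noncomm_ring
      _ = _ := by
        rw [h4, star_mul, mul_sub, sub_mul, mul_smul_comm, smul_mul_assoc, mul_one]
        noncomm_ring
  rw [h3, map_sub, map_smul, Complex.sub_re, smul_eq_mul, Complex.re_ofReal_mul, ← norm_sq_eq,
    ← norm_sq_eq] at h2
  rw [mul_pow]
  linarith

/-- Left multiplication by `a` on the pre-Hilbert space `TensorAlg`. -/
noncomputable def leftMul (a : TensorAlg) : TensorAlg →L[ℂ] TensorAlg :=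
  LinearMap.mkContinuousOfExistsBound (LinearMap.mulLeft ℂ a) (exists_mul_bound a)

theorem leftMul_apply (a b : TensorAlg) : leftMul a b = a * b := rfl

end TensorAlg

/-- The Hilbert space `L²(⨂ M₂(ℂ), τ)`: the completion of the algebraic infinite tensor product
for `‖a‖₂ = τ(a* a)^{1/2}`. -/
abbrev L2 : Type := UniformSpace.Completion TensorAlg

/-- The representation of the algebraic infinite tensor product on `L2` by left
multiplication. -/
noncomputable def leftRep : TensorAlg →⋆ₐ[ℂ] (L2 →L[ℂ] L2) where
  toFun a := (TensorAlg.leftMul a).completion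
  map_one' := by
    ext c
    induction c using UniformSpace.Completion.induction_on with
    | hp => apply isClosed_eq <;> fun_prop
    | ih c => simp [TensorAlg.leftMul_apply]
  map_mul' a b := by
    ext c
    induction c using UniformSpace.Completion.induction_on with
    | hp => apply isClosed_eq <;> fun_prop
    | ih c => simp [TensorAlg.leftMul_apply, mul_assoc]
  map_zero' := by
    ext c
    induction c using UniformSpace.Completion.induction_on with
    | hp => apply isClosed_eq <;> fun_prop
    | ih c => simp [TensorAlg.leftMul_apply, UniformSpace.Completion.coe_zero]
  map_add' a b := by
    ext c
    induction c using UniformSpace.Completion.induction_on with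
    | hp => apply isClosed_eq <;> fun_prop
    | ih c => simp [TensorAlg.leftMul_apply, add_mul, UniformSpace.Completion.coe_add]
  commutes' r := by
    ext c
    induction c using UniformSpace.Completion.induction_on with
    | hp => apply isClosed_eq <;> fun_prop
    | ih c => simp [TensorAlg.leftMul_apply, Algebra.algebraMap_eq_smul_one]
  map_star' a := by
    refine (ContinuousLinearMap.eq_adjoint_iff _ _).mpr fun x y => ?_
    induction x, y using UniformSpace.Completion.induction_on₂ with
    | hp => apply isClosed_eq <;> fun_prop
    | ih x y => simp [TensorAlg.leftMul_apply, TensorAlg.inner_def, mul_assoc]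

/-- The hyperfinite `II₁` factor `R`: the closure of the image of `leftRep` in the weak operator
topology. -/
def hyperfiniteFactor : Set (L2 →L[ℂ] L2) :=
  ContinuousLinearMapWOT.ofCLM ⁻¹'
    closure (ContinuousLinearMapWOT.ofCLM '' Set.range (leftRep : TensorAlg → (L2 →L[ℂ] L2)))

/-- The `2 × 2` matrix `V` with a single nonzero entry, a `1` in the upper right corner. -/
def matV : Matrix (Fin 2) (Fin 2) ℂ := !![0, 1; 0, 0]

/-- For `n ≥ 1`, the element `I^{⊗ (n-1)} ⊗ V` of `M₂(ℂ)^{⊗ n}`, seen in the algebraic infinite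
tensor product and acting on `L2` by left multiplication. -/
noncomputable def opV (n : ℕ) : L2 →L[ℂ] L2 :=
  leftRep (TensorAlg.of n (elemTensor fun k : Fin n => if (k : ℕ) + 1 = n then matV else 1))

/-- `A = ∑_{n ≥ 1} αⁿ V_n`, the sum being taken in the operator norm. -/
noncomputable def opA (α : ℝ) : L2 →L[ℂ] L2 :=
  ∑' n : ℕ, ((α : ℂ) ^ (n + 1)) • opV (n + 1)

end Hyperfinite

/-!
The Hilbert space `L2` also carries the action of the algebra by right multiplication, and the
vector state of the unit `Ω` is a trace on the commutant of that action: for `X` in the commutant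
`‖X* Ω‖ = ‖X Ω‖`, and polarization gives `⟪Ω, X Y Ω⟫ = ⟪Ω, Y X Ω⟫` (`isTraceVector_unitVec`).
All the `V_n` lie in this commutant, and so do the range projections of its elements. By the trace
property an idempotent of the commutant has the same trace as the orthogonal projection onto its
range (`IsTraceVector.inner_idempotent`).

Let `A_m` be the tail `∑ αⁿ V_n` over `n ≥ m`. Then `A_m = c V_m + B`, where `B = A_{m+1}` commutes
with the copy of `M₂(ℂ)` generated by `V_m`, so in terms of these matrix units `A_m ^ k` is the
upper triangular `2 × 2` matrix with diagonal entries `B ^ k` and corner `k c B ^ (k - 1)`. As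
`k c` is invertible, elementary row and column operations turn it into the diagonal matrix with
entries `B ^ (k - 1)` and `B ^ (k + 1)`. Conjugating the diagonal matrix of their range projections
by the row operation gives an idempotent whose range lies in the closure of the range of `A_m ^ k`.
Hence the trace `r m k` of the range projection of `A_m ^ k` satisfies
`r m k ≥ (r (m + 1) (k - 1) + r (m + 1) (k + 1)) / 2`
(`IsTraceVector.half_le_norm_rangeProj_pow`).

So the supremum over `m` of the defects `1 - r m k` is a convex function of `k`, with values in
`[0, 1]` and equal to `0` at `k = 0`. Such a function vanishes at `k = 1`: the unit lies in the
closure of the range of `A`, which is invariant under right multiplications, and is therefore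
everything (`IsTraceVector.denseRange`). The operators `V_n*` satisfy the same relations as the
`V_n`, so `A*` has dense range too, which means that `A` is injective.
-/

namespace Hyperfinite

/-! ### Range projections -/

section RangeProj

variable {H : Type*} [NormedAddCommGroup H] [InnerProductSpace ℂ H]

theorem apply_mem_topologicalClosure_of_commute {T X : H →L[ℂ] H} (h : Commute T X) {x : H}
    (hx : x ∈ X.range.topologicalClosure) : T x ∈ X.range.topologicalClosure := by
  refine map_mem_closure T.continuous hx ?_
  rintro _ ⟨y, rfl⟩
  exact ⟨T y, (congrArg (· y) h.eq.symm :)⟩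

variable [CompleteSpace H]

/-- The orthogonal projection onto the closure of the range of `X`. -/
noncomputable def rangeProj (X : H →L[ℂ] H) : H →L[ℂ] H :=
  X.range.topologicalClosure.starProjection

theorem rangeProj_apply_mem (X : H →L[ℂ] H) (x : H) :
    rangeProj X x ∈ X.range.topologicalClosure :=
  Submodule.starProjection_apply_mem _ x

theorem rangeProj_apply_eq_self {X : H →L[ℂ] H} {x : H}
    (hx : x ∈ X.range.topologicalClosure) : rangeProj X x = x :=
  Submodule.starProjection_eq_self_iff.mpr hx

theorem rangeProj_mul_self (X : H →L[ℂ] H) : rangeProj X * rangeProj X = rangeProj X :=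
  Submodule.isIdempotentElem_starProjection _

theorem commute_rangeProj {T X : H →L[ℂ] H} (h : Commute T X) (h' : Commute (star T) X) :
    Commute T (rangeProj X) := by
  ext x
  refine (Submodule.eq_starProjection_of_mem_of_inner_eq_zero
    (apply_mem_topologicalClosure_of_commute h (rangeProj_apply_mem X x)) fun w hw => ?_).symm
  change inner ℂ (T x - T (rangeProj X x)) w = 0
  rw [← map_sub, ← ContinuousLinearMap.adjoint_inner_right]
  exact Submodule.starProjection_inner_eq_zero _ _
    (apply_mem_topologicalClosure_of_commute h' hw)

theorem mul_rangeProj_apply_mem {X Y : H →L[ℂ] H} {K : Submodule ℂ H}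
    (hK : IsClosed (K : Set H)) (h : ∀ y, Y (X y) ∈ K) (x : H) : Y (rangeProj X x) ∈ K := by
  have h1 : Y (rangeProj X x) ∈ closure (K : Set H) := by
    refine map_mem_closure Y.continuous (rangeProj_apply_mem X x) ?_
    rintro _ ⟨y, rfl⟩
    exact h y
  rwa [hK.closure_eq] at h1

theorem inner_rangeProj_self (X : H →L[ℂ] H) (x : H) :
    inner ℂ x (rangeProj X x) = (‖rangeProj X x‖ ^ 2 : ℝ) := by
  have h : inner ℂ (rangeProj X x) (rangeProj X x) = inner ℂ x (rangeProj X x) := by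
    conv_rhs => rw [← rangeProj_apply_eq_self (rangeProj_apply_mem X x)]
    exact Submodule.inner_starProjection_left_eq_right _ _ _
  rw [← h, inner_self_eq_norm_sq_to_K]
  norm_cast

theorem norm_rangeProj_apply_le_of_le {X Y : H →L[ℂ] H}
    (h : X.range ≤ Y.range.topologicalClosure) (x : H) : ‖rangeProj X x‖ ≤ ‖rangeProj Y x‖ := by
  have h1 : X.range.topologicalClosure ≤ Y.range.topologicalClosure :=
    Submodule.topologicalClosure_minimal _ h (Submodule.isClosed_topologicalClosure _)
  have h2 := congrArg (· x) (Submodule.starProjection_comp_starProjection_of_le h1)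
  have h3 : rangeProj X (rangeProj Y x) = rangeProj X x := h2
  rw [← h3]
  exact Submodule.norm_starProjection_apply_le _ _

end RangeProj

/-! ### Traces of idempotents -/

section Trace

variable {H : Type*} [NormedAddCommGroup H] [InnerProductSpace ℂ H] [CompleteSpace H]

/-- The vector functional of `Ω` is a trace on the commutant of `S ∪ S*`. -/
def IsTraceVector (S : Set (H →L[ℂ] H)) (Ω : H) : Prop :=
  ∀ X ∈ StarSubalgebra.centralizer ℂ S, ∀ Y ∈ StarSubalgebra.centralizer ℂ S,
    inner ℂ Ω ((X * Y) Ω) = inner ℂ Ω ((Y * X) Ω)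

theorem rangeProj_mem_centralizer {S : Set (H →L[ℂ] H)} {X : H →L[ℂ] H}
    (hX : X ∈ StarSubalgebra.centralizer ℂ S) :
    rangeProj X ∈ StarSubalgebra.centralizer ℂ S := by
  rw [StarSubalgebra.mem_centralizer_iff] at hX ⊢
  intro g hg
  refine ⟨commute_rangeProj (hX g hg).1 (hX g hg).2, commute_rangeProj (hX g hg).2 ?_⟩
  rw [star_star]
  exact (hX g hg).1

/-- An idempotent has the same trace as the orthogonal projection onto its range: each of the two
fixes the range of the other. -/
theorem IsTraceVector.inner_idempotent {S : Set (H →L[ℂ] H)} {Ω : H} (hΩ : IsTraceVector S Ω)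
    {F : H →L[ℂ] H} (hF : F ∈ StarSubalgebra.centralizer ℂ S) (hFF : F * F = F) :
    inner ℂ Ω (F Ω) = (‖rangeProj F Ω‖ ^ 2 : ℝ) := by
  have h1 : rangeProj F * F = F := by
    ext x
    exact rangeProj_apply_eq_self (Submodule.le_topologicalClosure _ ⟨x, rfl⟩)
  have h2 : F * rangeProj F = rangeProj F := by
    ext x
    have hcl : IsClosed ((F - 1 : H →L[ℂ] H).ker : Set H) := (F - 1).isClosed_ker
    have : rangeProj F x ∈ (F - 1 : H →L[ℂ] H).ker :=
      mul_rangeProj_apply_mem (Y := 1) hcl (fun y => by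
        have := congrArg (· y) hFF
        simpa [sub_eq_zero] using this) x
    simpa [sub_eq_zero] using this
  have h3 := hΩ _ (rangeProj_mem_centralizer hF) _ hF
  rw [h1, h2] at h3
  rw [h3, inner_rangeProj_self]

end Trace

/-! ### Splitting off one tensor factor -/

section Algebra

theorem add_pow_succ_of_sq_eq_zero {R : Type*} [Ring R] [Algebra ℂ R] {v B : R}
    (hv : v * v = 0) (hvB : Commute v B) (c : ℂ) (j : ℕ) :
    (c • v + B) ^ (j + 1) = B ^ (j + 1) + (((j + 1 : ℕ) : ℂ) * c) • (v * B ^ j) := by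
  have hc := hvB.eq
  induction j with
  | zero => simp [add_comm]
  | succ j ih =>
    have h1 : B * (v * B ^ j) = v * B ^ (j + 1) := by
      rw [← mul_assoc, ← hc, mul_assoc, ← pow_succ']
    have h2 : v * (v * B ^ j) = 0 := by rw [← mul_assoc, hv, zero_mul]
    rw [pow_succ' _ (j + 1), ih, mul_add, add_mul, add_mul, ← pow_succ', smul_mul_assoc,
      smul_mul_assoc, mul_smul_comm, mul_smul_comm, h1, h2]
    push_cast
    module

theorem mul_mul_cancel_of_anticomm {R : Type*} [Ring R] {v w : R} (hv : v * v = 0)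
    (hvw : v * w + w * v = 1) (x : R) : v * (w * (v * x)) = v * x := by
  have h := congrArg (v * · * x) hvw
  simp only [mul_add, ← mul_assoc, hv, zero_mul, zero_add, mul_one] at h
  simpa only [← mul_assoc] using h

/-- With respect to the matrix units `v * w, v, w, w * v`, the operator `P * B + a • v * P` is the
`2 × 2` matrix with rows `(P * B, a • P)` and `(0, P * B)`. Up to an invertible factor on the right,
it is `1 + a⁻¹ • w * B` times the diagonal matrix with entries `P` and `P * B * B`; the two
identities express each column of that product through the operator. -/
theorem column_identities {R : Type*} [Ring R] [Algebra ℂ R] {v w B P : R}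
    (hv : v * v = 0) (hw : w * w = 0) (hvw : v * w + w * v = 1)
    (hvB : Commute v B) (hwB : Commute w B) (hvP : Commute v P) (hwP : Commute w P)
    (hBP : Commute B P) {a : ℂ} (ha : a ≠ 0) :
    (1 + a⁻¹ • (w * B)) * (v * w) * P = (P * B + a • (v * P)) * (a⁻¹ • w) ∧
    (1 + a⁻¹ • (w * B)) * (w * v) * (P * B * B) =
      (P * B + a • (v * P)) * (B * (w * v) - a • v) := by
  have e2 : ∀ x, w * (w * x) = 0 := fun x => by rw [← mul_assoc, hw, zero_mul]
  have e3 : w * (v * w) = w := by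
    simpa using mul_mul_cancel_of_anticomm hw (by rw [add_comm, hvw]) 1
  have e4 : v * (w * v) = v := by simpa using mul_mul_cancel_of_anticomm hv hvw 1
  have l (x y : R) (h : Commute x y) (z : R) : x * (y * z) = y * (x * z) := by
    rw [← mul_assoc, h.eq, mul_assoc]
  constructor
  · simp only [add_mul, one_mul, smul_mul_assoc, mul_smul_comm, mul_assoc, hvP.eq, hwP.eq,
      l _ _ hwB, l _ _ hvP, l _ _ hBP, e3, smul_add, smul_smul, inv_mul_cancel₀ ha, one_smul]
    abel
  · simp only [add_mul, mul_sub, one_mul, smul_mul_assoc, mul_smul_comm, mul_assoc,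
      hvB.eq, hwB.eq, hvP.eq, l _ _ hvB, l _ _ hwB, l _ _ hvP, l _ _ hwP,
      e2, e4, hv, mul_zero, smul_zero, add_zero]
    abel

end Algebra

section Step

variable {H : Type*} [NormedAddCommGroup H] [InnerProductSpace ℂ H] [CompleteSpace H]

/-- Since `v` implements an equivalence between `star v * v` and `v * star v`, each of these
projections has half of the trace of any operator commuting with `v` and `star v`. -/
theorem IsTraceVector.inner_half {S : Set (H →L[ℂ] H)} {Ω : H} (hΩ : IsTraceVector S Ω)
    {v q : H →L[ℂ] H} (hvM : v ∈ StarSubalgebra.centralizer ℂ S)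
    (hqM : q ∈ StarSubalgebra.centralizer ℂ S)
    (hvw : v * star v + star v * v = 1) (hvq : Commute v q) :
    inner ℂ Ω ((v * star v * q) Ω) = inner ℂ Ω (q Ω) / 2 ∧
      inner ℂ Ω ((star v * v * q) Ω) = inner ℂ Ω (q Ω) / 2 := by
  have h1 : inner ℂ Ω ((v * star v * q) Ω) = inner ℂ Ω ((star v * v * q) Ω) := by
    have := hΩ v hvM (star v * q) (mul_mem (star_mem hvM) hqM)
    rwa [← mul_assoc, mul_assoc (star v), ← hvq.eq, ← mul_assoc] at this
  have h2 : inner ℂ Ω ((v * star v * q) Ω) + inner ℂ Ω ((star v * v * q) Ω) =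
      inner ℂ Ω (q Ω) := by
    rw [← inner_add_right, ← add_apply, ← add_mul, hvw, one_mul]
  constructor
  · linear_combination (h2 + h1) / 2
  · linear_combination (h2 - h1) / 2

/-- The trace of the range projection of `(c • v + B) ^ k` is at least the average of those of
`B ^ (k - 1)` and `B ^ (k + 1)`. -/
theorem IsTraceVector.half_le_norm_rangeProj_pow {S : Set (H →L[ℂ] H)} {Ω : H}
    (hΩ : IsTraceVector S Ω) {v B : H →L[ℂ] H} (hvM : v ∈ StarSubalgebra.centralizer ℂ S)
    (hBM : B ∈ StarSubalgebra.centralizer ℂ S) (hv : v * v = 0)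
    (hvw : v * star v + star v * v = 1) (hvB : Commute v B) (hwB : Commute (star v) B)
    {c : ℂ} (hc : c ≠ 0) (j : ℕ) :
    (‖rangeProj (B ^ j) Ω‖ ^ 2 + ‖rangeProj (B ^ (j + 2)) Ω‖ ^ 2) / 2 ≤
      ‖rangeProj ((c • v + B) ^ (j + 1)) Ω‖ ^ 2 := by
  set w := star v with hwdef
  have hw : w * w = 0 := by rw [hwdef, ← star_mul, hv, star_zero]
  have hwM : w ∈ StarSubalgebra.centralizer ℂ S := star_mem hvM
  set a : ℂ := ((j + 1 : ℕ) : ℂ) * c with hadef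
  have ha : a ≠ 0 := mul_ne_zero (Nat.cast_ne_zero.mpr j.succ_ne_zero) hc
  set p := rangeProj (B ^ j) with hp
  set q := rangeProj (B ^ (j + 2)) with hq
  have hpM : p ∈ StarSubalgebra.centralizer ℂ S := rangeProj_mem_centralizer (pow_mem hBM _)
  have hqM : q ∈ StarSubalgebra.centralizer ℂ S := rangeProj_mem_centralizer (pow_mem hBM _)
  have hvv : star w = v := star_star v
  have hvp : Commute v p := commute_rangeProj (hvB.pow_right _) (hwB.pow_right _)
  have hvq : Commute v q := commute_rangeProj (hvB.pow_right _) (hwB.pow_right _)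
  have hwp : Commute w p :=
    commute_rangeProj (hwB.pow_right _) (by rw [hvv]; exact hvB.pow_right _)
  have hwq : Commute w q :=
    commute_rangeProj (hwB.pow_right _) (by rw [hvv]; exact hvB.pow_right _)
  have e3 : w * v * (w * v) = w * v := by
    rw [mul_assoc, ← mul_assoc v, ← mul_assoc, ← mul_assoc]
    simpa [mul_assoc] using mul_mul_cancel_of_anticomm hw (by rwa [add_comm]) v
  have e4 : v * w * (v * w) = v * w := by
    simpa [mul_assoc] using mul_mul_cancel_of_anticomm hv hvw w
  -- `U * D * U'` is an idempotent with range in the closure of the range of the power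
  set D := v * w * p + w * v * q with hD
  set U := 1 + a⁻¹ • (w * B) with hU
  set U' := 1 - a⁻¹ • (w * B) with hU'
  have hDM : D ∈ StarSubalgebra.centralizer ℂ S :=
    add_mem (mul_mem (mul_mem hvM hwM) hpM) (mul_mem (mul_mem hwM hvM) hqM)
  have hwBM : a⁻¹ • (w * B) ∈ StarSubalgebra.centralizer ℂ S :=
    (StarSubalgebra.centralizer ℂ S).smul_mem (mul_mem hwM hBM) _
  have hUM : U ∈ StarSubalgebra.centralizer ℂ S := add_mem (one_mem _) hwBM
  have hUM' : U' ∈ StarSubalgebra.centralizer ℂ S := sub_mem (one_mem _) hwBM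
  have hUU : U' * U = 1 := by
    have : w * B * (w * B) = 0 := by
      rw [mul_assoc, ← mul_assoc B, ← hwB.eq, mul_assoc, ← mul_assoc w, hw, zero_mul]
    rw [hU, hU', sub_mul, one_mul, mul_add, mul_one, smul_mul_smul_comm, this]
    simp
  have hDD : D * D = D := by
    have c1 : Commute p (v * w) := (hvp.mul_left hwp).symm
    have c2 : Commute q (w * v) := (hwq.mul_left hvq).symm
    have c3 : Commute p (w * v) := (hwp.mul_left hvp).symm
    have c4 : Commute q (v * w) := (hvq.mul_left hwq).symm
    have z1 : v * w * (w * v) = 0 := by rw [mul_assoc, ← mul_assoc w, hw]; simp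
    have z2 : w * v * (v * w) = 0 := by rw [mul_assoc, ← mul_assoc v, hv]; simp
    have m (x y f g : H →L[ℂ] H) (h : Commute f y) : x * f * (y * g) = x * y * (f * g) := by
      rw [mul_assoc, ← mul_assoc f, h.eq, mul_assoc, mul_assoc]
    rw [hD, add_mul, mul_add, mul_add, m _ _ _ _ c1, m _ _ _ _ c2, m _ _ _ _ c3, m _ _ _ _ c4,
      z1, z2, e3, e4, rangeProj_mul_self, rangeProj_mul_self]
    simp [hp, hq]
  have hFF : U * D * U' * (U * D * U') = U * D * U' := by
    calc U * D * U' * (U * D * U') = U * D * (U' * U) * D * U' := by noncomm_ring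
      _ = U * (D * D) * U' := by rw [hUU]; noncomm_ring
      _ = _ := by rw [hDD]
  have hFM : U * D * U' ∈ StarSubalgebra.centralizer ℂ S := mul_mem (mul_mem hUM hDM) hUM'
  have htr : inner ℂ Ω ((U * D * U') Ω) =
      (((‖p Ω‖ ^ 2 + ‖q Ω‖ ^ 2) / 2 : ℝ) : ℂ) := by
    rw [hΩ _ (mul_mem hUM hDM) _ hUM', ← mul_assoc, hUU, one_mul, hD,
      add_apply, inner_add_right, (hΩ.inner_half hvM hpM hvw hvp).1,
      (hΩ.inner_half hvM hqM hvw hvq).2, hp, hq, inner_rangeProj_self, inner_rangeProj_self]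
    push_cast
    ring
  rw [hΩ.inner_idempotent hFM hFF] at htr
  rw [← Complex.ofReal_injective htr]
  gcongr
  apply norm_rangeProj_apply_le_of_le
  set K := ((c • v + B) ^ (j + 1)).range.topologicalClosure with hK
  have hKc : IsClosed (K : Set H) := Submodule.isClosed_topologicalClosure _
  obtain ⟨i1, i2⟩ := column_identities (P := B ^ j) hv hw hvw hvB hwB (hvB.pow_right j)
    (hwB.pow_right j) (Commute.self_pow B j) ha
  rw [← pow_succ, ← add_pow_succ_of_sq_eq_zero hv hvB] at i1 i2
  rw [← pow_succ] at i2
  have k1 : ∀ x, (U * (v * w)) (p x) ∈ K := mul_rangeProj_apply_mem hKc fun y =>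
    Submodule.le_topologicalClosure _ ⟨(a⁻¹ • w) y, (congrArg (· y) i1).symm⟩
  have k2 : ∀ x, (U * (w * v)) (q x) ∈ K := mul_rangeProj_apply_mem hKc fun y =>
    Submodule.le_topologicalClosure _ ⟨(B * (w * v) - a • v) y, (congrArg (· y) i2).symm⟩
  rintro _ ⟨x, rfl⟩
  have : (U * D * U') x = (U * (v * w)) (p (U' x)) + (U * (w * v)) (q (U' x)) := by
    rw [hD, mul_add, add_mul]; rfl
  change (U * D * U') x ∈ K
  rw [this]
  exact add_mem (k1 _) (k2 _)

end Step

/-! ### Sums of commuting square-zero operators -/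

/-- A sequence of families of `2 × 2` matrix units, those of different families commuting:
`v n` is the off-diagonal unit, so that `v n * star (v n)` and `star (v n) * v n` are complementary
projections. -/
structure IsTensorUnits {H : Type*} [NormedAddCommGroup H] [InnerProductSpace ℂ H]
    [CompleteSpace H] (v : ℕ → H →L[ℂ] H) : Prop where
  mul_self : ∀ n, v n * v n = 0
  mul_star_add : ∀ n, v n * star (v n) + star (v n) * v n = 1
  commute : ∀ m n, m ≠ n → Commute (v m) (v n)
  commute_star : ∀ m n, m ≠ n → Commute (star (v m)) (v n)

/-- A discretely midpoint convex sequence that starts at zero and stays bounded by one cannot be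
positive at one: it grows at least linearly. -/
theorem le_zero_of_convex_of_le_one {g : ℕ → ℝ} (h0 : g 0 = 0) (h1 : ∀ k, g k ≤ 1)
    (h : ∀ k, 2 * g (k + 1) ≤ g k + g (k + 2)) : g 1 ≤ 0 := by
  have hinc : ∀ k, g 1 ≤ g (k + 1) - g k := by
    intro k
    induction k with
    | zero => simp [h0]
    | succ k ih => linarith [h k]
  have hlin : ∀ k : ℕ, k * g 1 ≤ g k := by
    intro k
    induction k with
    | zero => simp [h0]
    | succ k ih => push_cast; linarith [hinc k]
  by_contra! hpos
  obtain ⟨k, hk⟩ := exists_nat_gt (1 / g 1)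
  rw [div_lt_iff₀ hpos] at hk
  linarith [hlin k, h1 k]

section

variable {H : Type*} [NormedAddCommGroup H] [InnerProductSpace ℂ H] [CompleteSpace H]

theorem IsTensorUnits.star {v : ℕ → H →L[ℂ] H} (hv : IsTensorUnits v) :
    IsTensorUnits fun n => star (v n) where
  mul_self n := by rw [← star_mul, hv.mul_self, star_zero]
  mul_star_add n := by rw [star_star, add_comm, hv.mul_star_add]
  commute m n h := (hv.commute m n h).star_star
  commute_star m n h := by rw [star_star]; exact (hv.commute_star n m h.symm).symm

theorem IsTensorUnits.norm_le_one {v : ℕ → H →L[ℂ] H} (hv : IsTensorUnits v) (n : ℕ) :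
    ‖v n‖ ≤ 1 := by
  refine ContinuousLinearMap.opNorm_le_bound _ zero_le_one fun x => ?_
  rw [one_mul]
  refine le_of_sq_le_sq ?_ (norm_nonneg x)
  have h := congrArg (fun T : H →L[ℂ] H => (inner ℂ x (T x))) (hv.mul_star_add n)
  have h1 : inner ℂ x ((v n * Star.star (v n)) x) =
      inner ℂ (Star.star (v n) x) (Star.star (v n) x) :=
    (ContinuousLinearMap.adjoint_inner_left (v n) (Star.star (v n) x) x).symm
  have h2 : inner ℂ x ((Star.star (v n) * v n) x) = inner ℂ (v n x) (v n x) :=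
    ContinuousLinearMap.adjoint_inner_right (v n) x (v n x)
  have h3 : inner ℂ x ((1 : H →L[ℂ] H) x) = inner ℂ x x := rfl
  simp only [add_apply, inner_add_right, h1, h2, h3, inner_self_eq_norm_sq_to_K] at h
  norm_cast at h
  nlinarith [sq_nonneg ‖Star.star (v n) x‖]

theorem IsTensorUnits.summable {v : ℕ → H →L[ℂ] H} (hv : IsTensorUnits v) {c : ℕ → ℂ}
    (hc : Summable fun n => ‖c n‖) : Summable fun n => c n • v n := by
  refine Summable.of_norm_bounded hc fun n => ?_
  rw [norm_smul]
  exact mul_le_of_le_one_right (norm_nonneg _) (hv.norm_le_one n)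

theorem commute_tsum {ι : Type*} {f : ι → H →L[ℂ] H} (hf : Summable f) {T : H →L[ℂ] H}
    (h : ∀ i, Commute T (f i)) : Commute T (∑' i, f i) := by
  rw [Commute, SemiconjBy, ← hf.tsum_mul_left, ← hf.tsum_mul_right]
  exact tsum_congr fun i => (h i).eq

/-- A trace vector lies in the closure of the range of an infinite combination of tensor units.
With `r m k` the trace of the range projection of the `k`-th power of the tail starting at `m`,
splitting off one unit bounds `r m k` below by an average of `r (m + 1) (k - 1)` and
`r (m + 1) (k + 1)`. Hence `k ↦ ⨆ m, (1 - r m k)` is convex; it is bounded and vanishes at `0`. -/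
theorem IsTraceVector.mem_closure_range {S : Set (H →L[ℂ] H)} {Ω : H}
    (hΩ : IsTraceVector S Ω) (hΩ1 : ‖Ω‖ = 1) {v : ℕ → H →L[ℂ] H} (hv : IsTensorUnits v)
    (hvM : ∀ n, v n ∈ StarSubalgebra.centralizer ℂ S) {c : ℕ → ℂ} (hc0 : ∀ n, c n ≠ 0)
    (hc : Summable fun n => ‖c n‖) :
    Ω ∈ (∑' n, c n • v n).range.topologicalClosure := by
  -- the tails of the series
  let A : ℕ → H →L[ℂ] H := fun m => ∑' n, c (n + m) • v (n + m)
  have hsum : ∀ m, Summable fun n => c (n + m) • v (n + m) := fun m =>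
    (summable_nat_add_iff m).mpr (hv.summable hc)
  have hA : ∀ m, A m = c m • v m + A (m + 1) := fun m => by
    simp only [A]
    rw [(hsum m).tsum_eq_zero_add, zero_add]
    simp only [add_assoc, add_comm 1 m]
  have hAM : ∀ m, A m ∈ StarSubalgebra.centralizer ℂ S := fun m => by
    rw [StarSubalgebra.mem_centralizer_iff]
    intro g hg
    constructor <;> refine commute_tsum (hsum m) fun n => Commute.smul_right ?_ _
    · exact ((StarSubalgebra.mem_centralizer_iff ℂ).mp (hvM (n + m)) g hg).1
    · exact ((StarSubalgebra.mem_centralizer_iff ℂ).mp (hvM (n + m)) g hg).2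
  let r : ℕ → ℕ → ℝ := fun m k => ‖rangeProj (A m ^ k) Ω‖ ^ 2
  have hr0 : ∀ m k, 0 ≤ r m k := fun m k => by positivity
  have hr : ∀ m k, (r (m + 1) k + r (m + 1) (k + 2)) / 2 ≤ r m (k + 1) := fun m k => by
    simp only [r]
    rw [hA m]
    refine hΩ.half_le_norm_rangeProj_pow (hvM m) (hAM (m + 1)) (hv.mul_self m)
      (hv.mul_star_add m) ?_ ?_ (hc0 m) k <;>
      refine commute_tsum (hsum (m + 1)) fun n => Commute.smul_right ?_ _
    · exact hv.commute _ _ (by omega)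
    · exact hv.commute_star _ _ (by omega)
  -- the largest defect of the trace of the range projection of the `k`-th power of a tail
  let g : ℕ → ℝ := fun k => ⨆ m, (1 - r m k)
  have hbdd : ∀ k, BddAbove (Set.range fun m => 1 - r m k) := fun k =>
    ⟨1, by rintro _ ⟨m, rfl⟩; linarith [hr0 m k]⟩
  have hle : ∀ m k, 1 - r m k ≤ g k := fun m k => le_ciSup (hbdd k) m
  have hg : g 1 ≤ 0 := by
    refine le_zero_of_convex_of_le_one ?_ (fun k => ciSup_le fun m => by linarith [hr0 m k])
      fun k => ?_
    · have : ∀ m, r m 0 = 1 := fun m => by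
        have : rangeProj (A m ^ 0) Ω = Ω :=
          rangeProj_apply_eq_self (Submodule.le_topologicalClosure _ ⟨Ω, by simp⟩)
        simp only [r, this, hΩ1, one_pow]
      simp [g, this]
    · have : g (k + 1) ≤ (g k + g (k + 2)) / 2 := ciSup_le fun m => by
        linarith [hr m k, hle (m + 1) k, hle (m + 1) (k + 2)]
      linarith
  have h1 : 1 ≤ ‖rangeProj (A 0) Ω‖ ^ 2 := by
    have := hle 0 1
    simp only [r, pow_one] at this
    linarith
  have h2 : ‖rangeProj (A 0) Ω‖ = ‖Ω‖ := by
    refine le_antisymm (Submodule.norm_starProjection_apply_le _ _) ?_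
    rw [hΩ1]
    nlinarith [norm_nonneg (rangeProj (A 0) Ω)]
  exact (Submodule.mem_iff_norm_starProjection _ _).mpr h2

/-- If the trace vector is moreover cyclic for `S`, the range is dense, as it is invariant under
`S`. -/
theorem IsTraceVector.denseRange {S : Set (H →L[ℂ] H)} {Ω : H}
    (hΩ : IsTraceVector S Ω) (hΩ1 : ‖Ω‖ = 1) (hcyc : Dense ((· Ω) '' S))
    {v : ℕ → H →L[ℂ] H} (hv : IsTensorUnits v)
    (hvM : ∀ n, v n ∈ StarSubalgebra.centralizer ℂ S) {c : ℕ → ℂ} (hc0 : ∀ n, c n ≠ 0)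
    (hc : Summable fun n => ‖c n‖) :
    DenseRange (∑' n, c n • v n : H →L[ℂ] H) := by
  have h := hΩ.mem_closure_range hΩ1 hv hvM hc0 hc
  refine dense_closure.mp (hcyc.mono ?_)
  rintro _ ⟨T, hT, rfl⟩
  refine apply_mem_topologicalClosure_of_commute ?_ h
  exact commute_tsum (hv.summable hc) fun n => Commute.smul_right
    ((StarSubalgebra.mem_centralizer_iff ℂ).mp (hvM n) T hT).1 _

end

/-! ### Right multiplication and the trace -/

namespace TensorAlg

theorem of_incl {m n : ℕ} (h : m ≤ n) (x : Level m) : of n (incl m n h x) = of m x :=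
  (DirectLimit.eq_of_le (f := incl) ⟨m, x⟩ n h).symm

theorem tau_mul_comm (a b : TensorAlg) : tau (a * b) = tau (b * a) := by
  obtain ⟨m, x, rfl⟩ := exists_of a
  obtain ⟨n, y, rfl⟩ := exists_of b
  rw [← of_incl (le_max_left m n) x, ← of_incl (le_max_right m n) y, ← map_mul, ← map_mul, tau_of,
    tau_of, Matrix.trace_mul_comm]

theorem norm_star_eq (a : TensorAlg) : ‖star a‖ = ‖a‖ := by
  rw [← sq_eq_sq₀ (norm_nonneg _) (norm_nonneg _), norm_sq_eq, norm_sq_eq, star_star, tau_mul_comm]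

theorem exists_mul_right_bound (b : TensorAlg) : ∃ C : ℝ, ∀ a : TensorAlg, ‖a * b‖ ≤ C * ‖a‖ := by
  obtain ⟨C, hC⟩ := exists_mul_bound (star b)
  refine ⟨C, fun a => ?_⟩
  rw [← norm_star_eq, star_mul, ← norm_star_eq a]
  exact hC _

/-- Right multiplication by `b` on the pre-Hilbert space `TensorAlg`. -/
noncomputable def rightMul (b : TensorAlg) : TensorAlg →L[ℂ] TensorAlg :=
  LinearMap.mkContinuousOfExistsBound (LinearMap.mulRight ℂ b) (exists_mul_right_bound b)

theorem rightMul_apply (a b : TensorAlg) : rightMul b a = a * b := rfl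

end TensorAlg

/-- Right multiplication by `b` on `L2`. -/
noncomputable def rightOp (b : TensorAlg) : L2 →L[ℂ] L2 := (TensorAlg.rightMul b).completion

theorem rightOp_coe (a b : TensorAlg) : rightOp b (a : L2) = ((a * b : TensorAlg) : L2) := by
  simp [rightOp, TensorAlg.rightMul_apply]

theorem leftRep_coe (a b : TensorAlg) : leftRep a (b : L2) = ((a * b : TensorAlg) : L2) := by
  change (TensorAlg.leftMul a).completion (b : L2) = _
  simp [TensorAlg.leftMul_apply]

theorem star_rightOp (b : TensorAlg) : star (rightOp b) = rightOp (star b) := by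
  refine ((ContinuousLinearMap.eq_adjoint_iff _ _).mpr fun x y => ?_).symm
  induction x, y using UniformSpace.Completion.induction_on₂ with
  | hp => apply isClosed_eq <;> fun_prop
  | ih x y =>
    rw [rightOp_coe, rightOp_coe, UniformSpace.Completion.inner_coe,
      UniformSpace.Completion.inner_coe, TensorAlg.inner_def, TensorAlg.inner_def, star_mul,
      star_star, mul_assoc, TensorAlg.tau_mul_comm, mul_assoc]

/-- The vector of `L2` given by the unit of the algebra. -/
noncomputable def unitVec : L2 := ((1 : TensorAlg) : L2)

theorem norm_unitVec : ‖unitVec‖ = 1 := by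
  rw [unitVec, UniformSpace.Completion.norm_coe, ← sq_eq_sq₀ (norm_nonneg _) zero_le_one,
    TensorAlg.norm_sq_eq, star_one, one_mul, ← map_one (TensorAlg.of 0), TensorAlg.tau_of]
  simp

theorem rightOp_unitVec (b : TensorAlg) : rightOp b unitVec = (b : L2) := by
  rw [unitVec, rightOp_coe, one_mul]

theorem dense_rightOp_unitVec : Dense ((· unitVec) '' Set.range rightOp) := by
  refine (UniformSpace.Completion.denseRange_coe (α := TensorAlg)).mono ?_
  rintro _ ⟨b, rfl⟩
  exact ⟨rightOp b, ⟨b, rfl⟩, rightOp_unitVec b⟩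

theorem leftRep_mem_centralizer (a : TensorAlg) :
    leftRep a ∈ StarSubalgebra.centralizer ℂ (Set.range rightOp) := by
  have h : ∀ b, rightOp b * leftRep a = leftRep a * rightOp b := fun b => by
    ext x
    change rightOp b (leftRep a x) = leftRep a (rightOp b x)
    induction x using UniformSpace.Completion.induction_on with
    | hp => apply isClosed_eq <;> fun_prop
    | ih x => rw [leftRep_coe, rightOp_coe, rightOp_coe, leftRep_coe, mul_assoc]
  rw [StarSubalgebra.mem_centralizer_iff]
  rintro _ ⟨b, rfl⟩
  exact ⟨h b, star_rightOp b ▸ h (star b)⟩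

theorem norm_star_apply_unitVec_le {X : L2 →L[ℂ] L2}
    (hX : X ∈ StarSubalgebra.centralizer ℂ (Set.range rightOp)) :
    ‖star X unitVec‖ ≤ ‖X unitVec‖ := by
  have key : ∀ ξ : L2, ‖inner ℂ (star X unitVec) ξ‖ ≤ ‖ξ‖ * ‖X unitVec‖ := by
    intro ξ
    induction ξ using UniformSpace.Completion.induction_on with
    | hp => apply isClosed_le <;> fun_prop
    | ih b =>
      have h1 : inner ℂ (star X unitVec) (b : L2) =
          inner ℂ ((star b : TensorAlg) : L2) (X unitVec) := by
        have h2 : X (b : L2) = rightOp b (X unitVec) := by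
          rw [← rightOp_unitVec b]
          exact (congrArg (· unitVec)
            ((StarSubalgebra.mem_centralizer_iff ℂ).mp hX _ ⟨b, rfl⟩).1).symm
        calc inner ℂ (star X unitVec) (b : L2) = inner ℂ unitVec (X (b : L2)) :=
              ContinuousLinearMap.adjoint_inner_left X _ _
          _ = inner ℂ (star (rightOp b) unitVec) (X unitVec) := by
            rw [h2]; exact (ContinuousLinearMap.adjoint_inner_left (rightOp b) _ _).symm
          _ = _ := by rw [star_rightOp, rightOp_unitVec]
      rw [h1]
      refine (norm_inner_le_norm _ _).trans_eq ?_
      rw [UniformSpace.Completion.norm_coe, TensorAlg.norm_star_eq,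
        UniformSpace.Completion.norm_coe]
  have h := key (star X unitVec)
  rw [inner_self_eq_norm_sq_to_K] at h
  norm_cast at h
  rw [abs_pow, abs_norm, sq] at h
  by_contra! hlt
  nlinarith [norm_nonneg (X unitVec)]

theorem norm_star_apply_unitVec {X : L2 →L[ℂ] L2}
    (hX : X ∈ StarSubalgebra.centralizer ℂ (Set.range rightOp)) :
    ‖star X unitVec‖ = ‖X unitVec‖ := by
  refine le_antisymm (norm_star_apply_unitVec_le hX) ?_
  simpa using norm_star_apply_unitVec_le (star_mem hX)

/-- Polarizing `‖star X unitVec‖ = ‖X unitVec‖` shows that the vector functional of the unit is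
a trace on the commutant of the right multiplications. -/
theorem isTraceVector_unitVec : IsTraceVector (Set.range rightOp) unitVec := by
  intro X hX Y hY
  have h1 : inner ℂ unitVec ((X * Y) unitVec) = inner ℂ (star X unitVec) (Y unitVec) :=
    (ContinuousLinearMap.adjoint_inner_left X _ _).symm
  have h2 : inner ℂ unitVec ((Y * X) unitVec) = inner ℂ (star Y unitVec) (X unitVec) :=
    (ContinuousLinearMap.adjoint_inner_left Y _ _).symm
  have key : ∀ c : ℂ, ‖c‖ = 1 →
      ‖star X unitVec + c • Y unitVec‖ = ‖star Y unitVec + c • X unitVec‖ := by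
    intro c hc
    have h := norm_star_apply_unitVec
      (add_mem (star_mem hX) ((StarSubalgebra.centralizer ℂ _).smul_mem hY c))
    have h3 : c • (X + star c • star Y) = star Y + c • X := by
      have : c * star c = 1 := by
        rw [Complex.star_def, Complex.mul_conj, Complex.normSq_eq_norm_sq, hc]; simp
      rw [smul_add, smul_smul, this, one_smul, add_comm]
    rw [star_add, star_star, star_smul] at h
    calc ‖star X unitVec + c • Y unitVec‖ = ‖(X + star c • star Y) unitVec‖ := h.symm
      _ = ‖c • (X + star c • star Y) unitVec‖ := by rw [norm_smul, hc, one_mul]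
      _ = ‖(c • (X + star c • star Y)) unitVec‖ := rfl
      _ = _ := by rw [h3]; rfl
  have k1 := key 1 (by simp)
  have k2 := key (-1) (by simp)
  have k3 := key Complex.I (by simp)
  have k4 := key (-Complex.I) (by simp)
  simp only [one_smul, neg_smul, ← sub_eq_add_neg] at k1 k2 k3 k4
  rw [h1, h2, inner_eq_sum_norm_sq_div_four, inner_eq_sum_norm_sq_div_four, k1, k2]
  simp only [RCLike.I_to_complex, k3, k4]

/-! ### Elementary tensors supported at one site -/

theorem elemTensor_mul {n : ℕ} (x y : Fin n → Matrix (Fin 2) (Fin 2) ℂ) :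
    elemTensor x * elemTensor y = elemTensor fun k => x k * y k := by
  ext i j
  simp only [elemTensor, Matrix.mul_apply, Matrix.of_apply, ← Finset.prod_mul_distrib]
  rw [Finset.prod_univ_sum, Fintype.piFinset_univ]

theorem star_elemTensor {n : ℕ} (x : Fin n → Matrix (Fin 2) (Fin 2) ℂ) :
    star (elemTensor x) = elemTensor fun k => star (x k) := by
  ext i j
  simp [elemTensor, Matrix.star_apply]

/-- The inclusion `x ↦ x ⊗ 1` pads an elementary tensor with unit factors. -/
theorem incl_elemTensor {m n : ℕ} (h : m ≤ n) {x : Fin m → Matrix (Fin 2) (Fin 2) ℂ}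
    {y : Fin n → Matrix (Fin 2) (Fin 2) ℂ} (hxy : ∀ l, y (Fin.castLE h l) = x l)
    (hy : ∀ l : Fin n, m ≤ (l : ℕ) → y l = 1) : incl m n h (elemTensor x) = elemTensor y := by
  obtain ⟨d, rfl⟩ := Nat.exists_eq_add_of_le h
  ext i j
  have h1 : ∀ l : Fin d, y (Fin.natAdd m l) (i (Fin.natAdd m l)) (j (Fin.natAdd m l)) =
      if i (Fin.natAdd m l) = j (Fin.natAdd m l) then 1 else 0 := fun l => by
    rw [hy _ (by simp), Matrix.one_apply]
  have h2 : (∀ k : Fin (m + d), m ≤ (k : ℕ) → i k = j k) ↔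
      ∀ l : Fin d, i (Fin.natAdd m l) = j (Fin.natAdd m l) := by
    refine ⟨fun hk l => hk _ (by simp), fun hl k hk => ?_⟩
    have := hl ⟨k - m, by omega⟩
    have e : Fin.natAdd m ⟨k - m, by omega⟩ = k := Fin.ext (by simp; omega)
    rwa [e] at this
  rw [incl_apply]
  simp only [elemTensor, Matrix.of_apply]
  rw [Fin.prod_univ_add]
  simp only [h1, Fintype.prod_boole, h2, mul_ite, mul_one, mul_zero]
  refine if_congr Iff.rfl (Finset.prod_congr rfl fun l _ => ?_) rfl
  rw [← hxy]
  rfl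

/-- The elementary tensor in `M₂(ℂ)^{⊗ n}` with `X` in place `k` (counted from zero) and `1`
elsewhere; it is `1` if `n ≤ k`. -/
def siteLevel (n k : ℕ) (X : Matrix (Fin 2) (Fin 2) ℂ) : Level n :=
  elemTensor fun l : Fin n => if (l : ℕ) + 1 = k + 1 then X else 1

/-- The matrix `X` in tensor factor `k` (counted from zero) of the infinite tensor product. -/
noncomputable def site (k : ℕ) (X : Matrix (Fin 2) (Fin 2) ℂ) : TensorAlg :=
  TensorAlg.of (k + 1) (siteLevel (k + 1) k X)

theorem of_siteLevel {n k : ℕ} (h : k < n) (X : Matrix (Fin 2) (Fin 2) ℂ) :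
    TensorAlg.of n (siteLevel n k X) = site k X := by
  rw [site, ← TensorAlg.of_incl (Nat.succ_le_of_lt h), siteLevel, siteLevel, incl_elemTensor]
  · intro l; rfl
  · intro l hl
    rw [if_neg (by omega)]

theorem site_mul (k : ℕ) (X Y : Matrix (Fin 2) (Fin 2) ℂ) :
    site k X * site k Y = site k (X * Y) := by
  rw [site, site, site, ← map_mul, siteLevel, siteLevel, elemTensor_mul]
  congr 2
  ext1 l
  split_ifs <;> simp

theorem star_site (k : ℕ) (X : Matrix (Fin 2) (Fin 2) ℂ) : star (site k X) = site k (star X) := by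
  rw [site, site, ← map_star, siteLevel, star_elemTensor]
  congr 2
  ext1 l
  split_ifs <;> simp

theorem commute_site {k l : ℕ} (h : k ≠ l) (X Y : Matrix (Fin 2) (Fin 2) ℂ) :
    Commute (site k X) (site l Y) := by
  have hk : k < k + l + 1 := by omega
  have hl : l < k + l + 1 := by omega
  rw [Commute, SemiconjBy, ← of_siteLevel hk, ← of_siteLevel hl, ← map_mul, ← map_mul, siteLevel,
    siteLevel, elemTensor_mul, elemTensor_mul]
  congr 2
  ext1 p
  split_ifs <;> first | omega | simp

/-- The entries of `siteLevel` are linear in `X`, being a product with one entry of `X`. -/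
theorem siteLevel_succ_apply (k : ℕ) (X : Matrix (Fin 2) (Fin 2) ℂ) (i j : Fin (k + 1) → Fin 2) :
    siteLevel (k + 1) k X i j =
      (if ∀ l : Fin k, i l.castSucc = j l.castSucc then 1 else 0) *
        X (i (Fin.last k)) (j (Fin.last k)) := by
  simp only [siteLevel, elemTensor, Matrix.of_apply, Fin.prod_univ_castSucc]
  congr 1
  · refine ((Finset.prod_congr rfl fun l _ => ?_).trans (Fintype.prod_boole
      (p := fun l : Fin k => i l.castSucc = j l.castSucc))).trans (by congr)
    have hl : ¬ ((l.castSucc : Fin (k + 1)) : ℕ) + 1 = k + 1 := by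
      rw [Fin.val_castSucc]; omega
    rw [if_neg hl, Matrix.one_apply]
  · simp

theorem site_add (k : ℕ) (X Y : Matrix (Fin 2) (Fin 2) ℂ) :
    site k X + site k Y = site k (X + Y) := by
  rw [site, site, site, ← map_add]
  congr 1
  ext i j
  simp only [Matrix.add_apply, siteLevel_succ_apply, mul_add]

theorem site_zero (k : ℕ) : site k 0 = 0 := by
  have h := site_add k 0 0
  rwa [add_zero, add_eq_left] at h

theorem site_one (k : ℕ) : site k 1 = 1 := by
  rw [site, ← map_one (TensorAlg.of (k + 1))]
  congr 1
  ext i j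
  simp only [siteLevel, elemTensor, ite_self, Matrix.of_apply, Matrix.one_apply,
    Fintype.prod_boole, funext_iff]
  congr

theorem opV_succ (n : ℕ) : opV (n + 1) = leftRep (site n matV) := rfl

/-- The relations `V² = 0` and `V V* + V* V = 1` hold in each factor, and different factors
commute. -/
theorem isTensorUnits_opV : IsTensorUnits fun n => opV (n + 1) where
  mul_self n := by
    have : matV * matV = 0 := by ext i j; fin_cases i <;> fin_cases j <;> simp [matV]
    rw [opV_succ, ← map_mul, site_mul, this, site_zero, map_zero]
  mul_star_add n := by
    have : matV * star matV + star matV * matV = 1 := by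
      ext i j
      simp only [Matrix.add_apply, Matrix.mul_apply, Fin.sum_univ_two, Matrix.star_apply]
      fin_cases i <;> fin_cases j <;> simp [matV]
    rw [opV_succ, ← map_star, star_site, ← map_mul, ← map_mul, site_mul, site_mul, ← map_add,
      site_add, this, site_one, map_one]
  commute m n h := (commute_site h matV matV).map leftRep
  commute_star m n h := by
    rw [opV_succ, opV_succ, ← map_star, star_site]
    exact (commute_site h _ _).map leftRep

theorem opV_succ_mem_centralizer (n : ℕ) :
    opV (n + 1) ∈ StarSubalgebra.centralizer ℂ (Set.range rightOp) :=
  leftRep_mem_centralizer _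

end Hyperfinite

theorem mainTheorem4 (α : ℝ) (hα₀ : 0 < α) (hα₁ : α < 1) :
    HasSum (fun n : ℕ => ((α : ℂ) ^ (n + 1)) • Hyperfinite.opV (n + 1)) (Hyperfinite.opA α) ∧
      Hyperfinite.opA α ∈ Hyperfinite.hyperfiniteFactor ∧
      (Hyperfinite.opA α).ker = ⊥ ∧
      DenseRange (Hyperfinite.opA α) := by
  have hα : (α : ℂ) ≠ 0 := Complex.ofReal_ne_zero.mpr hα₀.ne'
  have hc : Summable fun n : ℕ => ‖(α : ℂ) ^ (n + 1)‖ := by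
    simp only [norm_pow, Complex.norm_real, Real.norm_eq_abs, abs_of_pos hα₀]
    exact (summable_nat_add_iff 1).mpr (summable_geometric_of_lt_one hα₀.le hα₁)
  have hsum : HasSum (fun n : ℕ => ((α : ℂ) ^ (n + 1)) • Hyperfinite.opV (n + 1))
      (Hyperfinite.opA α) := (Hyperfinite.isTensorUnits_opV.summable hc).hasSum
  refine ⟨hsum, ?_, ?_, ?_⟩
  · -- norm limits of elements of the represented algebra are limits in the weak operator topology
    refine mem_closure_of_tendsto
      ((ContinuousLinearMapWOT.continuous_ofCLM.tendsto _).comp hsum) (.of_forall fun s => ?_)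
    refine ⟨_, ⟨∑ n ∈ s, ((α : ℂ) ^ (n + 1)) • Hyperfinite.site n Hyperfinite.matV, ?_⟩, rfl⟩
    rw [map_sum]
    exact Finset.sum_congr rfl fun n _ => map_smul _ _ _
  · -- the adjoint of `A` is a series of the same kind, so its range is dense
    have hstar := hsum.star
    simp only [star_smul, star_pow] at hstar
    have hd := Hyperfinite.isTraceVector_unitVec.denseRange Hyperfinite.norm_unitVec
      Hyperfinite.dense_rightOp_unitVec Hyperfinite.isTensorUnits_opV.star
      (fun n => star_mem (Hyperfinite.opV_succ_mem_centralizer n))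
      (c := fun n => star (α : ℂ) ^ (n + 1)) (fun n => pow_ne_zero _ (star_ne_zero.mpr hα))
      (by simpa only [norm_pow, norm_star] using hc)
    rw [hstar.tsum_eq] at hd
    refine (Submodule.eq_bot_iff _).mpr fun x hx => ?_
    refine hd.eq_zero_of_inner_left ℂ fun y => ?_
    have hAx : Hyperfinite.opA α x = 0 := hx
    rw [← inner_conj_symm, ContinuousLinearMap.star_eq_adjoint,
      ContinuousLinearMap.adjoint_inner_left, hAx, inner_zero_right, map_zero]
  · exact Hyperfinite.isTraceVector_unitVec.denseRange Hyperfinite.norm_unitVec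
      Hyperfinite.dense_rightOp_unitVec Hyperfinite.isTensorUnits_opV
      Hyperfinite.opV_succ_mem_centralizer (fun n => pow_ne_zero _ hα) hc
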